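/- Let $\Omega\subset\mathbb{R}^d$ be a bounded open set. Let $A:\Omega\to\mathbb{R}^{d\times d}$ be a matrix field with entries in $L^\infty(\Omega)$ such that, for almost every $x\in\Omega$, $A(x)$ is symmetric and $A(x)\xi\cdot\xi\ge c_1|\xi|^2$ for all $\xi\in\mathbb{R}^d$, with a constant $c_1>0$. Let $f\in L^\infty(\Omega)$, let $\alpha_+,\alpha_->0$ be constants, and let $u_D\in H^1(\Omega)$. Write $V_0=H^1_0(\Omega)$ for the closure of $C_c^\infty(\Omega)$ in $H^1(\Omega)$, $z_+=\max\{0,z\}$, $z_-=-\min\{0,z\}$, and $$\|y\|_A^2=\int_\Omega Ay\cdot y\,dx,\qquad \|y\|_{A^{-1}}^2=\int_\Omega A^{-1}y\cdot y\,dx .$$ Let $u$ be a minimizer over $V_0+u_D$ of the energy of the double obstacle (two-phase obstacle) problem, $$J(v)=\int_\Omega\Big(\tfrac12 A\nabla v\cdot\nabla v-fv+\alpha_+v_++\alpha_-v_-\Big)dx,$$ and let $p^*=A\nabla u$ be the exact flux. Then for every $v\in V_0+u_D$ and every $y^*\in L^2(\Omega,\mathbb{R}^d)$ with a weak divergence satisfying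 $-\alpha_-\le \operatorname{div}y^*+f\le\alpha_+$ almost everywhere in $\Omega$, $$\tfrac12\|\nabla(u-v)\|_A^2+\tfrac12\|p^*-y^*\|_{A^{-1}}^2\;\le\;\tfrac12\|A\nabla v-y^*\|_{A^{-1}}^2+\Upsilon(v,y^*),$$ where $$\Upsilon(v,y^*)=\int_\Omega\big(\alpha_+v_++\alpha_-v_--(f+\operatorname{div}y^*)\,v\big)\,dx .$$ -/

import Mathlib

open MeasureTheory Filter Topology
open scoped Distributions

namespace DoubleObstacle

noncomputable section

/-- `ℝ^d` with its Euclidean norm. -/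
abbrev Space (d : ℕ) : Type := EuclideanSpace ℝ (Fin d)

/-- An open subset of `ℝ^d`. -/
abbrev Region (d : ℕ) : Type := TopologicalSpace.Opens (Space d)

/-- Lebesgue measure restricted to `Ω`. -/
abbrev vol {d : ℕ} (Ω : Region d) : Measure (Space d) :=
  volume.restrict (Ω : Set (Space d))

/-- `G` is the weak gradient of `w` in `Ω`: both are locally integrable, and
`∫_Ω w ∇φ = - ∫_Ω φ G` for every `φ ∈ C_c^∞(Ω)`. -/
def HasWeakGradient {d : ℕ} (Ω : Region d) (w : Space d → ℝ) (G : Space d → Space d) : Prop :=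
  LocallyIntegrableOn w (Ω : Set (Space d)) ∧
  LocallyIntegrableOn G (Ω : Set (Space d)) ∧
  ∀ φ : 𝓓(Ω, ℝ), ∫ x, w x • gradient φ x ∂(vol Ω) = - ∫ x, φ x • G x ∂(vol Ω)

/-- `g` is the weak divergence of the vector field `y` in `Ω`: both are locally integrable, and
`∫_Ω y · ∇φ = - ∫_Ω g φ` for every `φ ∈ C_c^∞(Ω)`. -/
def HasWeakDivergence {d : ℕ} (Ω : Region d) (y : Space d → Space d) (g : Space d → ℝ) : Prop :=
  LocallyIntegrableOn y (Ω : Set (Space d)) ∧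
  LocallyIntegrableOn g (Ω : Set (Space d)) ∧
  ∀ φ : 𝓓(Ω, ℝ), ∫ x, inner ℝ (y x) (gradient φ x) ∂(vol Ω) = - ∫ x, g x * φ x ∂(vol Ω)

/-- The Sobolev space `H¹(Ω)`: an element is a square-integrable function (a representative)
together with (a representative of) its square-integrable weak gradient. -/
structure H1 {d : ℕ} (Ω : Region d) where
  toFun : Space d → ℝ
  grad : Space d → Space d
  memLp_toFun : MemLp toFun 2 (vol Ω)
  memLp_grad : MemLp grad 2 (vol Ω)
  hasWeakGradient : HasWeakGradient Ω toFun grad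

instance {d : ℕ} (Ω : Region d) : CoeFun (H1 Ω) (fun _ => Space d → ℝ) := ⟨H1.toFun⟩

/-- The affine space `V₀ + u_D`, where `V₀ = H¹₀(Ω)` is the closure of `C_c^∞(Ω)` in `H¹(Ω)`:
those `v ∈ H¹(Ω)` for which `v - u_D` is an `H¹`-limit of functions in `C_c^∞(Ω)`. -/
def admissible {d : ℕ} (Ω : Region d) (uD : H1 Ω) : Set (H1 Ω) :=
  {v | ∃ φ : ℕ → 𝓓(Ω, ℝ),
    Tendsto (fun n => eLpNorm (fun x => (v x - uD x) - φ n x) 2 (vol Ω)) atTop (𝓝 0) ∧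
    Tendsto (fun n => eLpNorm (fun x => (v.grad x - uD.grad x) - gradient (φ n) x) 2 (vol Ω))
      atTop (𝓝 0)}

/-- `M y` for a matrix `M` and a vector `y ∈ ℝ^d`. -/
def act {d : ℕ} (M : Matrix (Fin d) (Fin d) ℝ) (y : Space d) : Space d :=
  WithLp.toLp 2 (M.mulVec y.ofLp)

/-- `‖y‖²_A = ∫_Ω A y · y`. -/
def energyNormSq {d : ℕ} (Ω : Region d) (A : Space d → Matrix (Fin d) (Fin d) ℝ)
    (y : Space d → Space d) : ℝ :=
  ∫ x, inner ℝ (act (A x) (y x)) (y x) ∂(vol Ω)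

/-- The coefficient matrix: essentially bounded (and measurable), symmetric, and uniformly
elliptic almost everywhere in `Ω`. -/
structure IsCoefficient {d : ℕ} (Ω : Region d)
    (A : Space d → Matrix (Fin d) (Fin d) ℝ) : Prop where
  memLp_top : ∀ i j, MemLp (fun x => A x i j) ⊤ (vol Ω)
  symm : ∀ᵐ x ∂(vol Ω), (A x).IsSymm
  elliptic : ∃ c₁ : ℝ, 0 < c₁ ∧
    ∀ᵐ x ∂(vol Ω), ∀ ξ : Space d, c₁ * ‖ξ‖ ^ 2 ≤ inner ℝ (act (A x) ξ) ξ

/-- The energy `J(v) = ∫_Ω (½ A∇v·∇v - f v + α₊ v₊ + α₋ v₋)`; here `z⁺ = max z 0` and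
`z⁻ = max (-z) 0`. -/
def energy {d : ℕ} (Ω : Region d) (A : Space d → Matrix (Fin d) (Fin d) ℝ) (f : Space d → ℝ)
    (αp αm : ℝ) (v : H1 Ω) : ℝ :=
  ∫ x, ((1 / 2) * inner ℝ (act (A x) (v.grad x)) (v.grad x) - f x * v x
    + αp * (v x)⁺ + αm * (v x)⁻) ∂(vol Ω)

/-- `u` is a minimizer of the energy over `V₀ + u_D`. -/
def IsMinimizer {d : ℕ} (Ω : Region d) (A : Space d → Matrix (Fin d) (Fin d) ℝ)
    (f : Space d → ℝ) (αp αm : ℝ) (uD u : H1 Ω) : Prop :=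
  u ∈ admissible Ω uD ∧ IsMinOn (energy Ω A f αp αm) (admissible Ω uD) u

/-- The exact flux `p* = A∇u`. -/
def flux {d : ℕ} {Ω : Region d} (A : Space d → Matrix (Fin d) (Fin d) ℝ) (u : H1 Ω) :
    Space d → Space d :=
  fun x => act (A x) (u.grad x)

/-- `y ∈ L²(Ω, ℝ^d)` has weak divergence `divy` and `divy + f ∈ [-α₋, α₊]` a.e. in `Ω`. -/
def IsAdmissibleFlux {d : ℕ} (Ω : Region d) (f : Space d → ℝ) (αp αm : ℝ)
    (y : Space d → Space d) (divy : Space d → ℝ) : Prop :=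
  MemLp y 2 (vol Ω) ∧ HasWeakDivergence Ω y divy ∧
  ∀ᵐ x ∂(vol Ω), divy x + f x ∈ Set.Icc (-αm) αp

/-- `Υ(v, y*) = ∫_Ω (α₊ v₊ + α₋ v₋ - (f + div y*) v)`. -/
def Upsilon {d : ℕ} (Ω : Region d) (f : Space d → ℝ) (αp αm : ℝ) (v : H1 Ω)
    (divy : Space d → ℝ) : ℝ :=
  ∫ x, (αp * (v x)⁺ + αm * (v x)⁻ - (f x + divy x) * v x) ∂(vol Ω)

end

end DoubleObstacle

namespace DoubleObstacle

variable {d : ℕ} {Ω : Region d}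

/-! Neither an Euler-Lagrange equation nor duality is needed. Write `J = ½‖∇·‖²_A + P`. The
quadratic part is uniformly convex and `P` is convex, so minimality of `u` gives `½‖∇(u-v)‖²_A ≤
J(v) - J(u)` (`IsMinimizer.half_energyNormSq_sub_le`). Expanding the squares
(`IsCoefficient.energyNormSq_inv_sub`) gives `½‖A∇u-y‖² - ½‖A∇v-y‖² = ½‖∇u‖²_A - ½‖∇v‖²_A -
∫∇(u-v)·y`, with the `A⁻¹`-norm on the left. By Green's formula (`integral_inner_sub_eq`) the last
term is `+∫ div y (u-v)`. On adding the two, the quadratic terms cancel and what remains is `Υ(v,y)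
- Υ(u,y)`. The constraint on `div y + f` makes `Υ(u,y) ≥ 0` (`mul_le_posPart_add_negPart`). -/

theorem memLp_gradient (φ : 𝓓(Ω, ℝ)) (p : ENNReal) : MemLp (gradient φ) p (vol Ω) := by
  have hc : Continuous (gradient φ) :=
    (InnerProductSpace.toDual ℝ (Space d)).symm.continuous.comp
      (φ.contDiff.continuous_fderiv (by simp))
  have hs : HasCompactSupport (gradient φ) :=
    (φ.hasCompactSupport.fderiv (𝕜 := ℝ)).comp_left (map_zero _)
  exact hc.memLp_of_hasCompactSupport hs

theorem memLp_testFunction (φ : 𝓓(Ω, ℝ)) (p : ENNReal) : MemLp φ p (vol Ω) :=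
  φ.continuous.memLp_of_hasCompactSupport φ.hasCompactSupport

/-! ### Pairings in `L²`. -/

section L2

variable {α E : Type*} [MeasurableSpace α] {μ : Measure α}
  [NormedAddCommGroup E] [InnerProductSpace ℝ E]

theorem integrable_inner_of_memLp_two {a b : α → E} (ha : MemLp a 2 μ) (hb : MemLp b 2 μ) :
    Integrable (fun x => inner ℝ (a x) (b x)) μ := by
  refine memLp_one_iff_integrable.1 (MemLp.of_bilin (p := 2) (q := 2) (inner ℝ) 1 ha hb
    (ha.1.inner hb.1) (.of_forall fun x => ?_))
  simpa using nnnorm_inner_le_nnnorm (𝕜 := ℝ) (a x) (b x)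

/-- By Hölder, the `L¹` distance of the integrands is at most `‖a - b n‖₂ ‖y‖₂`. -/
theorem tendsto_integral_inner {a y : α → E} {b : ℕ → α → E} (ha : MemLp a 2 μ)
    (hb : ∀ n, MemLp (b n) 2 μ) (hy : MemLp y 2 μ)
    (h : Tendsto (fun n => eLpNorm (fun x => a x - b n x) 2 μ) atTop (𝓝 0)) :
    Tendsto (fun n => ∫ x, inner ℝ (b n x) (y x) ∂μ) atTop (𝓝 (∫ x, inner ℝ (a x) (y x) ∂μ)) := by
  refine tendsto_integral_of_L1' _ (integrable_inner_of_memLp_two ha hy).1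
    (.of_forall fun n => integrable_inner_of_memLp_two (hb n) hy) ?_
  have hlim : Tendsto (fun n => eLpNorm (fun x => a x - b n x) 2 μ * eLpNorm y 2 μ)
      atTop (𝓝 0) := by
    simpa using ENNReal.Tendsto.mul_const h (Or.inr hy.2.ne)
  refine tendsto_of_tendsto_of_tendsto_of_le_of_le tendsto_const_nhds hlim
    (fun _ => zero_le) fun n => ?_
  have key := eLpNorm_le_eLpNorm_mul_eLpNorm_of_nnnorm (p := 2) (q := 2) (r := 1)
    (ha.sub (hb n)).1 hy.1 (inner ℝ) 1 (.of_forall fun x => by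
      simpa using nnnorm_inner_le_nnnorm (𝕜 := ℝ) ((a - b n) x) (y x))
  rw [ENNReal.coe_one, one_mul] at key
  refine le_trans (le_of_eq ?_) key
  rw [← eLpNorm_neg]
  congr 1
  ext x
  simp [inner_sub_left]

end L2

/-! ### Green's formula on `H¹₀`. -/

/-- Green's formula extends from test functions to their `H¹`-limits. -/
theorem integral_inner_eq_of_tendsto {w : Space d → ℝ} {G y : Space d → Space d}
    {g : Space d → ℝ} (hw : MemLp w 2 (vol Ω)) (hG : MemLp G 2 (vol Ω)) (hy : MemLp y 2 (vol Ω))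
    (hg : MemLp g 2 (vol Ω)) (h : HasWeakDivergence Ω y g) (φ : ℕ → 𝓓(Ω, ℝ))
    (hφ : Tendsto (fun n => eLpNorm (fun x => w x - φ n x) 2 (vol Ω)) atTop (𝓝 0))
    (hφ' : Tendsto (fun n => eLpNorm (fun x => G x - gradient (φ n) x) 2 (vol Ω)) atTop (𝓝 0)) :
    ∫ x, inner ℝ (G x) (y x) ∂(vol Ω) = -∫ x, g x * w x ∂(vol Ω) := by
  have h1 := tendsto_integral_inner hG (fun n => memLp_gradient (φ n) 2) hy hφ'
  have h2 := (tendsto_integral_inner hw (fun n => memLp_testFunction (φ n) 2) hg hφ).neg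
  refine tendsto_nhds_unique h1 (h2.congr fun n => ?_)
  simpa [real_inner_comm] using (h.2.2 (φ n)).symm

/-- Both `u - uD` and `v - uD` are limits of test functions, so Green's formula applies to each; the
boundary datum drops out on subtracting. -/
theorem integral_inner_sub_eq {uD u v : H1 Ω} (hu : u ∈ admissible Ω uD)
    (hv : v ∈ admissible Ω uD) {y : Space d → Space d} {g : Space d → ℝ}
    (hy : MemLp y 2 (vol Ω)) (hg : MemLp g 2 (vol Ω)) (h : HasWeakDivergence Ω y g) :
    ∫ x, (inner ℝ (u.grad x - v.grad x) (y x) + g x * (u x - v x)) ∂(vol Ω) = 0 := by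
  have key : ∀ w ∈ admissible Ω uD, Integrable (fun x => inner ℝ (w.grad x - uD.grad x) (y x)
        + g x * (w x - uD x)) (vol Ω) ∧
      ∫ x, (inner ℝ (w.grad x - uD.grad x) (y x) + g x * (w x - uD x)) ∂(vol Ω) = 0 := by
    rintro w ⟨φ, h1, h2⟩
    have e1 := w.memLp_toFun.sub uD.memLp_toFun
    have e2 := w.memLp_grad.sub uD.memLp_grad
    have i1 : Integrable (fun x => inner ℝ (w.grad x - uD.grad x) (y x)) (vol Ω) :=
      integrable_inner_of_memLp_two e2 hy
    have i2 : Integrable (fun x => g x * (w x - uD x)) (vol Ω) := hg.integrable_mul e1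
    refine ⟨i1.add i2, ?_⟩
    rw [integral_add i1 i2]
    have := integral_inner_eq_of_tendsto e1 e2 hy hg h φ h1 h2
    simp only [Pi.sub_apply] at this
    linarith
  obtain ⟨iu, eu⟩ := key u hu
  obtain ⟨iv, ev⟩ := key v hv
  rw [← sub_zero (0 : ℝ)]
  nth_rewrite 1 [← eu]
  rw [← ev, ← integral_sub iu iv]
  congr 1
  ext x
  simp only [inner_sub_left]
  ring

/-! ### Convex combinations of admissible functions. -/

/-- The convex combination `(1 - t) u + t v` in `H¹(Ω)`. -/
noncomputable def H1.combo (u v : H1 Ω) (t : ℝ) : H1 Ω where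
  toFun x := (1 - t) * u x + t * v x
  grad x := (1 - t) • u.grad x + t • v.grad x
  memLp_toFun := (u.memLp_toFun.const_mul (1 - t)).add (v.memLp_toFun.const_mul t)
  memLp_grad := (u.memLp_grad.const_smul (1 - t)).add (v.memLp_grad.const_smul t)
  hasWeakGradient := by
    have hf (w : H1 Ω) (φ : 𝓓(Ω, ℝ)) (c : ℝ) :
        Integrable (fun x => (c * w x) • gradient φ x) (vol Ω) :=
      memLp_one_iff_integrable.1
        ((memLp_gradient φ 2).smul (r := 1) (w.memLp_toFun.const_mul c))
    have hg (w : H1 Ω) (φ : 𝓓(Ω, ℝ)) (c : ℝ) :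
        Integrable (fun x => φ x • (c • w.grad x)) (vol Ω) :=
      memLp_one_iff_integrable.1
        ((w.memLp_grad.const_smul c).smul (r := 1) (memLp_testFunction φ 2))
    refine ⟨?_, ?_, fun φ => ?_⟩
    · exact locallyIntegrableOn_of_locallyIntegrable_restrict
        (((u.memLp_toFun.const_mul (1 - t)).add (v.memLp_toFun.const_mul t)).locallyIntegrable
          one_le_two)
    · exact locallyIntegrableOn_of_locallyIntegrable_restrict
        (((u.memLp_grad.const_smul (1 - t)).add (v.memLp_grad.const_smul t)).locallyIntegrable
          one_le_two)
    · have e (w : H1 Ω) (c : ℝ) : ∫ x, (c * w x) • gradient φ x ∂(vol Ω)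
          = -∫ x, φ x • (c • w.grad x) ∂(vol Ω) := by
        simp only [mul_smul, smul_comm (φ _) c]
        rw [integral_smul, integral_smul, w.hasWeakGradient.2.2 φ, smul_neg]
      simp only [add_smul, smul_add]
      rw [integral_add (hf u φ _) (hf v φ _), integral_add (hg u φ _) (hg v φ _), e, e, neg_add]

theorem combo_mem_admissible {uD u v : H1 Ω} (hu : u ∈ admissible Ω uD)
    (hv : v ∈ admissible Ω uD) (t : ℝ) : u.combo v t ∈ admissible Ω uD := by
  obtain ⟨φ, h1, h2⟩ := hu
  obtain ⟨ψ, h3, h4⟩ := hv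
  -- The values in `F` are left general so that one estimate serves both the functions and their
  -- gradients.
  have key {F : Type} [NormedAddCommGroup F] [NormedSpace ℝ F] {a b c : Space d → F}
      {α β : ℕ → Space d → F} (ha : MemLp a 2 (vol Ω)) (hb : MemLp b 2 (vol Ω))
      (hc : MemLp c 2 (vol Ω))
      (hα : ∀ n, MemLp (α n) 2 (vol Ω)) (hβ : ∀ n, MemLp (β n) 2 (vol Ω))
      (h : Tendsto (fun n => eLpNorm (fun x => a x - c x - α n x) 2 (vol Ω)) atTop (𝓝 0))
      (h' : Tendsto (fun n => eLpNorm (fun x => b x - c x - β n x) 2 (vol Ω)) atTop (𝓝 0)) :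
      Tendsto (fun n => eLpNorm (fun x => ((1 - t) • a x + t • b x) - c x
        - ((1 - t) • α n x + t • β n x)) 2 (vol Ω)) atTop (𝓝 0) := by
    have hlim : Tendsto (fun n => ‖1 - t‖ₑ * eLpNorm (fun x => a x - c x - α n x) 2 (vol Ω)
        + ‖t‖ₑ * eLpNorm (fun x => b x - c x - β n x) 2 (vol Ω)) atTop (𝓝 0) := by
      simpa using (ENNReal.Tendsto.const_mul h (Or.inr enorm_ne_top)).add
        (ENNReal.Tendsto.const_mul h' (Or.inr enorm_ne_top))
    refine tendsto_of_tendsto_of_tendsto_of_le_of_le tendsto_const_nhds hlim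
      (fun _ => zero_le) fun n => ?_
    have m1 : MemLp (fun x => a x - c x - α n x) 2 (vol Ω) := (ha.sub hc).sub (hα n)
    have m2 : MemLp (fun x => b x - c x - β n x) 2 (vol Ω) := (hb.sub hc).sub (hβ n)
    simp only
    rw [← eLpNorm_const_smul, ← eLpNorm_const_smul]
    refine le_trans (le_of_eq ?_) (eLpNorm_add_le (m1.const_smul (1 - t)).1 (m2.const_smul t).1
      one_le_two)
    congr 1
    ext1 x
    simp only [Pi.add_apply, Pi.smul_apply]
    module
  refine ⟨fun n => (1 - t) • φ n + t • ψ n, ?_, ?_⟩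
  · exact key u.memLp_toFun v.memLp_toFun uD.memLp_toFun (fun n => memLp_testFunction _ 2)
      (fun n => memLp_testFunction _ 2) h1 h3
  · have hgrad (n : ℕ) : gradient ((1 - t) • φ n + t • ψ n)
        = fun x => (1 - t) • gradient (φ n) x + t • gradient (ψ n) x := by
      ext1 x
      have d1 : DifferentiableAt ℝ (φ n) x := (φ n).contDiff.differentiable (by simp) x
      have d2 : DifferentiableAt ℝ (ψ n) x := (ψ n).contDiff.differentiable (by simp) x
      have : fderiv ℝ ((1 - t) • ⇑(φ n) + t • ⇑(ψ n)) x
          = (1 - t) • fderiv ℝ (φ n) x + t • fderiv ℝ (ψ n) x :=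
        ((d1.hasFDerivAt.const_smul (1 - t)).add (d2.hasFDerivAt.const_smul t)).fderiv
      simp [gradient, this]
    simp only [hgrad]
    exact key u.memLp_grad v.memLp_grad uD.memLp_grad (fun n => memLp_gradient _ 2)
      (fun n => memLp_gradient _ 2) h2 h4

/-! ### Pointwise algebra of the coefficient matrix. -/

section Matrix

variable (M : Matrix (Fin d) (Fin d) ℝ)

theorem act_add (a b : Space d) : act M (a + b) = act M a + act M b := by
  simp [act, Matrix.mulVec_add]

theorem act_sub (a b : Space d) : act M (a - b) = act M a - act M b := by
  simp [act, Matrix.mulVec_sub]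

theorem act_smul (c : ℝ) (a : Space d) : act M (c • a) = c • act M a := by
  simp [act, Matrix.mulVec_smul]

variable {M}

theorem inner_act_comm (hM : M.IsSymm) (a b : Space d) :
    inner ℝ (act M a) b = inner ℝ a (act M b) := by
  simp only [act, EuclideanSpace.inner_eq_star_dotProduct, star_trivial]
  rw [Matrix.dotProduct_mulVec, ← Matrix.mulVec_transpose, hM.eq, dotProduct_comm,
    dotProduct_comm]

/-- Reduces measurability and integrability of the form to those of the entries. -/
theorem inner_act_eq_sum (a b : Space d) :
    inner ℝ (act M a) b = ∑ i, ∑ j, M i j * (a j * b i) := by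
  simp only [act, PiLp.inner_apply, Matrix.mulVec, dotProduct, RCLike.inner_apply, conj_trivial,
    Finset.mul_sum]
  refine Finset.sum_congr rfl fun i _ => Finset.sum_congr rfl fun j _ => ?_
  ring

variable {c : ℝ}

theorem isUnit_of_elliptic (hc : 0 < c) (h : ∀ ξ : Space d, c * ‖ξ‖ ^ 2 ≤ inner ℝ (act M ξ) ξ) :
    IsUnit M := by
  rw [← Matrix.mulVec_injective_iff_isUnit, ← Matrix.coe_mulVecLin,
    injective_iff_map_eq_zero]
  intro z hz
  have h0 := h (WithLp.toLp 2 z)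
  have hz' : act M (WithLp.toLp 2 z) = 0 := by
    simpa [act] using hz
  rw [hz', inner_zero_left] at h0
  have : ‖WithLp.toLp 2 z‖ ^ 2 ≤ 0 := by nlinarith
  have : WithLp.toLp 2 z = 0 := by
    simpa using le_antisymm this (sq_nonneg _)
  simpa using this

theorem act_inv_act (hM : IsUnit M) (a : Space d) : act M⁻¹ (act M a) = a := by
  have := M.isUnit_iff_isUnit_det.1 hM
  simp [act, Matrix.nonsing_inv_mul _ this]

theorem act_act_inv (hM : IsUnit M) (a : Space d) : act M (act M⁻¹ a) = a := by
  have := M.isUnit_iff_isUnit_det.1 hM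
  simp [act, Matrix.mul_nonsing_inv _ this]

/-- With `z = M⁻¹a`, ellipticity and Cauchy-Schwarz give `c‖z‖² ≤ a·z ≤ ‖a‖‖z‖`, hence `‖z‖ ≤
c⁻¹‖a‖`. -/
theorem norm_inner_act_inv_le (hc : 0 < c)
    (h : ∀ ξ : Space d, c * ‖ξ‖ ^ 2 ≤ inner ℝ (act M ξ) ξ) (a : Space d) :
    ‖inner ℝ (act M⁻¹ a) a‖ ≤ c⁻¹ * ‖a‖ ^ 2 := by
  set z := act M⁻¹ a
  have h1 := h z
  rw [act_act_inv (isUnit_of_elliptic hc h)] at h1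
  have h2 := h1.trans (real_inner_le_norm a z)
  have h3 : ‖z‖ ≤ c⁻¹ * ‖a‖ := by
    rw [le_inv_mul_iff₀ hc]
    rcases (norm_nonneg z).eq_or_lt with h0 | h0
    · simp [← h0]
    · nlinarith
  calc ‖inner ℝ z a‖ ≤ ‖z‖ * ‖a‖ := norm_inner_le_norm z a
    _ ≤ c⁻¹ * ‖a‖ * ‖a‖ := by gcongr
    _ = _ := by ring

theorem inner_act_inv_sub (hM : IsUnit M) (hs : M.IsSymm) (a y : Space d) :
    inner ℝ (act M⁻¹ (act M a - y)) (act M a - y)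
      = inner ℝ (act M a) a - 2 * inner ℝ a y + inner ℝ (act M⁻¹ y) y := by
  have h : inner ℝ (act M⁻¹ y) (act M a) = inner ℝ a y := by
    rw [← inner_act_comm hs, act_act_inv hM, real_inner_comm]
  rw [act_sub, act_inv_act hM, inner_sub_left, inner_sub_right, inner_sub_right, h,
    real_inner_comm (act M a) a]
  ring

/-- The cross terms occur only as the sum `Ma·b + Mb·a`, so symmetry plays no role. -/
theorem inner_act_combo (a b : Space d) (t : ℝ) :
    inner ℝ (act M ((1 - t) • a + t • b)) ((1 - t) • a + t • b)
      = (1 - t) * inner ℝ (act M a) a + t * inner ℝ (act M b) b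
        - t * (1 - t) * inner ℝ (act M (a - b)) (a - b) := by
  simp only [act_add, act_smul, act_sub, inner_add_left, inner_add_right, inner_sub_left,
    inner_sub_right, real_inner_smul_left, real_inner_smul_right]
  ring

end Matrix

theorem memLp_apply {a : Space d → Space d} {p : ENNReal} {μ : Measure (Space d)}
    (ha : MemLp a p μ) (i : Fin d) : MemLp (fun x => a x i) p μ :=
  (EuclideanSpace.proj (𝕜 := ℝ) i).comp_memLp' ha

/-! ### Integrated quadratic forms of `A` and `A⁻¹`. -/

section Coefficient

variable {A : Space d → Matrix (Fin d) (Fin d) ℝ} {a b : Space d → Space d}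

theorem IsCoefficient.integrable_inner_act (hA : IsCoefficient Ω A) (ha : MemLp a 2 (vol Ω))
    (hb : MemLp b 2 (vol Ω)) : Integrable (fun x => inner ℝ (act (A x) (a x)) (b x)) (vol Ω) := by
  simp only [inner_act_eq_sum]
  refine integrable_finsetSum _ fun i _ => integrable_finsetSum _ fun j _ => ?_
  exact memLp_one_iff_integrable.1 (((memLp_apply hb i).mul (r := 1) (memLp_apply ha j)).mul
    (r := 1) (hA.memLp_top i j))

/-- The inverse is the adjugate over the determinant: both are continuous in the entries, and scalar
inversion is measurable even at zero. -/
theorem IsCoefficient.aestronglyMeasurable_inv (hA : IsCoefficient Ω A) (i j : Fin d) :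
    AEStronglyMeasurable (fun x => (A x)⁻¹ i j) (vol Ω) := by
  have hm : AEMeasurable (fun x => (fun i j => A x i j : Fin d → Fin d → ℝ)) (vol Ω) :=
    aemeasurable_pi_lambda _ fun i => aemeasurable_pi_lambda _ fun j =>
      (hA.memLp_top i j).1.aemeasurable
  have hof : Continuous fun M : Fin d → Fin d → ℝ => Matrix.of M := continuous_id
  have hdet : Continuous fun M : Fin d → Fin d → ℝ => (Matrix.of M).det := hof.matrix_det
  have hadj : Continuous fun M : Fin d → Fin d → ℝ => (Matrix.of M).adjugate i j :=
    hof.matrix_adjugate.matrix_elem i j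
  simp only [Matrix.inv_def, Ring.inverse_eq_inv', Matrix.smul_apply, smul_eq_mul]
  exact ((hdet.measurable.comp_aemeasurable hm).inv.mul
    (hadj.measurable.comp_aemeasurable hm)).aestronglyMeasurable

theorem IsCoefficient.integrable_inner_act_inv (hA : IsCoefficient Ω A)
    (ha : MemLp a 2 (vol Ω)) :
    Integrable (fun x => inner ℝ (act (A x)⁻¹ (a x)) (a x)) (vol Ω) := by
  obtain ⟨c, hc, hell⟩ := hA.elliptic
  refine (((memLp_two_iff_integrable_sq_norm ha.1).1 ha).const_mul c⁻¹).mono' ?_ ?_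
  · simp only [inner_act_eq_sum]
    refine Finset.aestronglyMeasurable_fun_sum _ fun i _ =>
      Finset.aestronglyMeasurable_fun_sum _ fun j _ => ?_
    exact (hA.aestronglyMeasurable_inv i j).mul ((memLp_apply ha j).1.mul (memLp_apply ha i).1)
  · filter_upwards [hell] with x hx
    exact norm_inner_act_inv_le hc hx _

theorem IsCoefficient.ae_inner_act_inv_sub (hA : IsCoefficient Ω A) (a y : Space d → Space d) :
    ∀ᵐ x ∂(vol Ω), inner ℝ (act (A x)⁻¹ (act (A x) (a x) - y x)) (act (A x) (a x) - y x)
      = inner ℝ (act (A x) (a x)) (a x) - 2 * inner ℝ (a x) (y x)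
        + inner ℝ (act (A x)⁻¹ (y x)) (y x) := by
  obtain ⟨c, hc, hell⟩ := hA.elliptic
  filter_upwards [hell, hA.symm] with x hx hs
  exact inner_act_inv_sub (isUnit_of_elliptic hc hx) hs _ _

theorem IsCoefficient.energyNormSq_inv_sub (hA : IsCoefficient Ω A) {a y : Space d → Space d}
    (ha : MemLp a 2 (vol Ω)) (hy : MemLp y 2 (vol Ω)) :
    energyNormSq Ω (fun x => (A x)⁻¹) (fun x => act (A x) (a x) - y x)
      = energyNormSq Ω A a - 2 * (∫ x, inner ℝ (a x) (y x) ∂(vol Ω))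
        + energyNormSq Ω (fun x => (A x)⁻¹) y := by
  have h1 := hA.integrable_inner_act ha ha
  have h2 := (integrable_inner_of_memLp_two ha hy).const_mul 2
  have h3 := hA.integrable_inner_act_inv hy
  simp only [energyNormSq]
  rw [integral_congr_ae (hA.ae_inner_act_inv_sub a y), ← integral_const_mul,
    ← integral_sub h1 h2, ← integral_add (by exact h1.sub h2) h3]

end Coefficient

theorem isFiniteMeasure_vol (hΩ : Bornology.IsBounded (Ω : Set (Space d))) :
    IsFiniteMeasure (vol Ω) :=
  isFiniteMeasure_restrict.2 hΩ.measure_lt_top.ne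

/-! ### Convexity of the energy and the dual constraint. -/

section Energy

variable {A : Space d → Matrix (Fin d) (Fin d) ℝ} {f : Space d → ℝ} {αp αm : ℝ}

theorem integrable_potential [IsFiniteMeasure (vol Ω)] (hf : MemLp f ⊤ (vol Ω)) (v : H1 Ω) :
    Integrable (fun x => αp * (v x)⁺ + αm * (v x)⁻ - f x * v x) (vol Ω) := by
  have hv : Integrable v (vol Ω) := v.memLp_toFun.integrable one_le_two
  have hp : Integrable (fun x => (v x)⁺) (vol Ω) := hv.pos_part
  have hm : Integrable (fun x => (v x)⁻) (vol Ω) := hv.neg_part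
  have hfv : Integrable (fun x => f x * v x) (vol Ω) :=
    memLp_one_iff_integrable.1 ((memLp_one_iff_integrable.2 hv).mul (r := 1) hf)
  exact ((hp.const_mul αp).add (hm.const_mul αm)).sub hfv

theorem energy_eq [IsFiniteMeasure (vol Ω)] (hA : IsCoefficient Ω A) (hf : MemLp f ⊤ (vol Ω))
    (v : H1 Ω) : energy Ω A f αp αm v = (1 / 2) * energyNormSq Ω A v.grad
      + ∫ x, (αp * (v x)⁺ + αm * (v x)⁻ - f x * v x) ∂(vol Ω) := by
  rw [energyNormSq, ← integral_const_mul, ← integral_add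
    ((hA.integrable_inner_act v.memLp_grad v.memLp_grad).const_mul _) (integrable_potential hf v)]
  refine integral_congr_ae (.of_forall fun x => ?_)
  ring

theorem energyNormSq_combo (hA : IsCoefficient Ω A) (u v : H1 Ω) (t : ℝ) :
    energyNormSq Ω A (u.combo v t).grad = (1 - t) * energyNormSq Ω A u.grad
      + t * energyNormSq Ω A v.grad
      - t * (1 - t) * energyNormSq Ω A (fun x => u.grad x - v.grad x) := by
  have hu := (hA.integrable_inner_act u.memLp_grad u.memLp_grad).const_mul (1 - t)
  have hv := (hA.integrable_inner_act v.memLp_grad v.memLp_grad).const_mul t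
  have hw := (hA.integrable_inner_act (u.memLp_grad.sub v.memLp_grad)
    (u.memLp_grad.sub v.memLp_grad)).const_mul (t * (1 - t))
  simp only [Pi.sub_apply] at hw
  simp only [energyNormSq]
  rw [← integral_const_mul, ← integral_const_mul, ← integral_const_mul, ← integral_add hu hv,
    ← integral_sub (by exact hu.add hv) hw]
  exact integral_congr_ae (.of_forall fun x => inner_act_combo _ _ _)

theorem integral_potential_combo_le [IsFiniteMeasure (vol Ω)] (hf : MemLp f ⊤ (vol Ω))
    (hαp : 0 ≤ αp) (hαm : 0 ≤ αm) (u v : H1 Ω) {t : ℝ} (h0 : 0 ≤ t) (h1 : t ≤ 1) :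
    ∫ x, (αp * (u.combo v t x)⁺ + αm * (u.combo v t x)⁻ - f x * u.combo v t x) ∂(vol Ω)
      ≤ (1 - t) * ∫ x, (αp * (u x)⁺ + αm * (u x)⁻ - f x * u x) ∂(vol Ω)
        + t * ∫ x, (αp * (v x)⁺ + αm * (v x)⁻ - f x * v x) ∂(vol Ω) := by
  have hu := (integrable_potential (αp := αp) (αm := αm) hf u).const_mul (1 - t)
  have hv := (integrable_potential (αp := αp) (αm := αm) hf v).const_mul t
  rw [← integral_const_mul, ← integral_const_mul, ← integral_add hu hv]
  refine integral_mono (integrable_potential hf _) (hu.add hv) fun x => ?_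
  have ht : 0 ≤ 1 - t := sub_nonneg.2 h1
  have hp : ((1 - t) * u x + t * v x)⁺ ≤ (1 - t) * (u x)⁺ + t * (v x)⁺ := by
    refine sup_le ?_ (by positivity)
    gcongr <;> exact le_posPart _
  have hm : ((1 - t) * u x + t * v x)⁻ ≤ (1 - t) * (u x)⁻ + t * (v x)⁻ := by
    refine sup_le ?_ (by positivity)
    have e1 := mul_le_mul_of_nonneg_left (neg_le_negPart (u x)) ht
    have e2 := mul_le_mul_of_nonneg_left (neg_le_negPart (v x)) h0
    linarith
  have hp' := mul_le_mul_of_nonneg_left hp hαp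
  have hm' := mul_le_mul_of_nonneg_left hm hαm
  simp only [H1.combo]
  linarith

/-- The energy controls the distance to its minimizer. -/
theorem IsMinimizer.half_energyNormSq_sub_le [IsFiniteMeasure (vol Ω)] (hA : IsCoefficient Ω A)
    (hf : MemLp f ⊤ (vol Ω)) (hαp : 0 ≤ αp) (hαm : 0 ≤ αm) {uD u v : H1 Ω}
    (hu : IsMinimizer Ω A f αp αm uD u) (hv : v ∈ admissible Ω uD) :
    (1 / 2) * energyNormSq Ω A (fun x => u.grad x - v.grad x)
      ≤ energy Ω A f αp αm v - energy Ω A f αp αm u := by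
  set D := energyNormSq Ω A (fun x => u.grad x - v.grad x) with hD
  have key : ∀ t ∈ Set.Ioo (0 : ℝ) 1, (1 - t) * ((1 / 2) * D)
      ≤ energy Ω A f αp αm v - energy Ω A f αp αm u := by
    rintro t ⟨h0, h1⟩
    have hmin : energy Ω A f αp αm u ≤ energy Ω A f αp αm (u.combo v t) :=
      hu.2 (combo_mem_admissible hu.1 hv t)
    have hpot := integral_potential_combo_le hf hαp hαm u v h0.le h1.le
    rw [energy_eq hA hf (u.combo v t), energyNormSq_combo hA, ← hD] at hmin
    rw [energy_eq hA hf u] at hmin ⊢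
    rw [energy_eq hA hf v]
    -- Minimality against the convex combination has a factor `t` in every remaining term; it is
    -- divided out here, and `t → 0` follows.
    refine le_of_mul_le_mul_left ?_ h0
    linarith
  have hlim : Tendsto (fun t : ℝ => (1 - t) * ((1 / 2) * D)) (𝓝[>] 0) (𝓝 ((1 / 2) * D)) := by
    have : Continuous fun t : ℝ => (1 - t) * ((1 / 2) * D) := by fun_prop
    simpa using (this.tendsto 0).mono_left nhdsWithin_le_nhds
  exact le_of_tendsto hlim (eventually_of_mem (Ioo_mem_nhdsGT one_pos) key)

/-- A weak divergence is a priori only locally integrable; the constraint bounds `g + f`, and `f` is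
bounded. -/
theorem IsAdmissibleFlux.memLp_div (hf : MemLp f ⊤ (vol Ω)) {y : Space d → Space d}
    {g : Space d → ℝ} (hy : IsAdmissibleFlux Ω f αp αm y g) : MemLp g ⊤ (vol Ω) := by
  have hm : AEStronglyMeasurable g (vol Ω) := hy.2.1.2.1.aestronglyMeasurable
  have : MemLp (fun x => g x + f x) ⊤ (vol Ω) := by
    refine memLp_top_of_bound (hm.add hf.1) (max αm αp) ?_
    filter_upwards [hy.2.2] with x hx
    exact abs_le.2 ⟨(neg_le_neg (le_max_left _ _)).trans hx.1, hx.2.trans (le_max_right _ _)⟩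
  have h := this.sub hf
  refine h.ae_eq (.of_forall fun x => ?_)
  simp

theorem mul_le_posPart_add_negPart {c : ℝ} (hc : c ∈ Set.Icc (-αm) αp) (z : ℝ) :
    c * z ≤ αp * z⁺ + αm * z⁻ := by
  have h1 := mul_le_mul_of_nonneg_right hc.2 (posPart_nonneg z)
  have h2 := mul_le_mul_of_nonneg_right hc.1 (negPart_nonneg z)
  have h3 : c * (z⁺ - z⁻) = c * z := by rw [posPart_sub_negPart]
  linarith

end Energy

end DoubleObstacle

/-! ### The error estimate. -/

theorem mainTheorem5 {d : ℕ} (Ω : DoubleObstacle.Region d)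
    (hΩ : Bornology.IsBounded (Ω : Set (DoubleObstacle.Space d)))
    (A : DoubleObstacle.Space d → Matrix (Fin d) (Fin d) ℝ)
    (hA : DoubleObstacle.IsCoefficient Ω A)
    (f : DoubleObstacle.Space d → ℝ) (hf : MemLp f ⊤ (DoubleObstacle.vol Ω))
    (αp αm : ℝ) (hαp : 0 < αp) (hαm : 0 < αm)
    (uD u : DoubleObstacle.H1 Ω)
    (hu : DoubleObstacle.IsMinimizer Ω A f αp αm uD u)
    (v : DoubleObstacle.H1 Ω) (hv : v ∈ DoubleObstacle.admissible Ω uD)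
    (y : DoubleObstacle.Space d → DoubleObstacle.Space d) (divy : DoubleObstacle.Space d → ℝ)
    (hy : DoubleObstacle.IsAdmissibleFlux Ω f αp αm y divy) :
    (1 / 2) * DoubleObstacle.energyNormSq Ω A (fun x => u.grad x - v.grad x)
      + (1 / 2) * DoubleObstacle.energyNormSq Ω (fun x => (A x)⁻¹)
          (fun x => DoubleObstacle.flux A u x - y x)
      ≤ (1 / 2) * DoubleObstacle.energyNormSq Ω (fun x => (A x)⁻¹)
          (fun x => DoubleObstacle.flux A v x - y x)
        + DoubleObstacle.Upsilon Ω f αp αm v divy := by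
  open DoubleObstacle in
  have := isFiniteMeasure_vol hΩ
  have hdist := hu.half_energyNormSq_sub_le hA hf hαp.le hαm.le hv
  have hdivTop := hy.memLp_div hf
  have hdiv : MemLp divy 2 (vol Ω) := hdivTop.mono_exponent le_top
  have hgreen := integral_inner_sub_eq hu.1 hv hy.1 hdiv hy.2.1
  have iuy := integrable_inner_of_memLp_two u.memLp_grad hy.1
  have ivy := integrable_inner_of_memLp_two v.memLp_grad hy.1
  have iu : Integrable (fun x => divy x * u x) (vol Ω) := hdiv.integrable_mul u.memLp_toFun
  have iv : Integrable (fun x => divy x * v x) (vol Ω) := hdiv.integrable_mul v.memLp_toFun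
  have pu := integrable_potential (αp := αp) (αm := αm) hf u
  have pv := integrable_potential (αp := αp) (αm := αm) hf v
  have hsplit : ∫ x, inner ℝ (u.grad x) (y x) ∂(vol Ω) - ∫ x, inner ℝ (v.grad x) (y x) ∂(vol Ω)
      + (∫ x, divy x * u x ∂(vol Ω) - ∫ x, divy x * v x ∂(vol Ω)) = 0 := by
    rw [← hgreen, ← integral_sub iuy ivy, ← integral_sub iu iv,
      ← integral_add (by exact iuy.sub ivy) (by exact iu.sub iv)]
    simp only [inner_sub_left, mul_sub]
  have hups : Upsilon Ω f αp αm v divy = ∫ x, (αp * (v x)⁺ + αm * (v x)⁻ - f x * v x) ∂(vol Ω)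
      - ∫ x, divy x * v x ∂(vol Ω) := by
    rw [Upsilon, ← integral_sub pv iv]
    simp only [add_mul, sub_sub]
  -- This is `Υ(u,y) ≥ 0`, the only inequality used besides `hdist`.
  have hle : ∫ x, divy x * u x ∂(vol Ω)
      ≤ ∫ x, (αp * (u x)⁺ + αm * (u x)⁻ - f x * u x) ∂(vol Ω) := by
    refine integral_mono_ae iu pu ?_
    filter_upwards [hy.2.2] with x hx
    have := mul_le_posPart_add_negPart hx (u x)
    simp only [add_mul] at this
    linarith
  rw [energy_eq hA hf u, energy_eq hA hf v] at hdist
  simp only [flux]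
  rw [hA.energyNormSq_inv_sub u.memLp_grad hy.1, hA.energyNormSq_inv_sub v.memLp_grad hy.1, hups]
  linarith
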